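/- Let $(X,d)$ be a countable metric space that is discrete (as a topological space), with $\operatorname{diam} X = 1$ and with a basepoint $0\in X$ satisfying $d(0,p)=1$ for all $p\in X\setminus\{0\}$. Write $B_\theta(p)=\{x : d(x,p)\le\theta\}$ and $B_\theta(F)=\bigcup_{p\in F}B_\theta(p)$. An \emph{ideal} is a collection $\mathcal I$ of closed subsets of $X$ that contains $\emptyset$ and is closed under passing to closed subsets and under finite unions; $\mathcal F$ denotes the ideal of finite subsets of $X$, and $\operatorname{ulm}(\mathcal I)\supseteq\mathcal I$ is the ideal of all closed $E\subseteq X$ for which there is $\theta>0$ such that $E\cap B_\theta(F)\in\mathcal I$ for every finite $F\subseteq X$. Let $\operatorname{Lip}(X)$ be the space of Lipschitz functions $f:X\to\mathbb R$ with $f(0)=0$, normed by $\|f\|=\sup_{p\ne q}|f(p)-f(q)|/d(p,q)$. For an ideal $\mathcal I$ let $\operatorname{Lip}_{\mathcal I}(X)\subseteq\operatorname{Lip}(X)$ be the normed subspace of those $f$ whose support $\overline{\{f\neq 0\}}$ belongs to $\mathcal I$, and let $\mathcal F_{\mathcal I}(X)$ be the norm closure in the dual $\operatorname{Lip}_{\mathcal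 I}(X)^*$ of the linear span of the evaluations $\delta_p$, $p\in X$. For ideals $\mathcal I_2\subseteq\mathcal I_1$ let $R^{\mathcal I_1}_{\mathcal I_2}:\mathcal F_{\mathcal I_1}(X)\to\mathcal F_{\mathcal I_2}(X)$ be the restriction of functionals to $\operatorname{Lip}_{\mathcal I_2}(X)$ (the bounded linear map with $\delta_p\mapsto\delta_p$). \textbf{Theorem.} Let $\mathcal I$ be an ideal with $\mathcal F\subseteq\mathcal I$ such that $R^{\mathcal I}_{\mathcal F}$ is injective, and set $\mathcal J=\operatorname{ulm}(\mathcal I)$. Then $R^{\mathcal J}_{\mathcal F}$ is injective, and $R^{\mathcal J}_{\mathcal I}:\mathcal F_{\mathcal J}(X)\to\mathcal F_{\mathcal I}(X)$ is a $7$-semi-embedding: it is injective, and, with $B$ the closed unit ball of $\mathcal F_{\mathcal J}(X)$, $\overline{R^{\mathcal J}_{\mathcal I}(B)}\subseteq R^{\mathcal J}_{\mathcal I}(7B)$. -/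

import Mathlib

open TopologicalSpace

set_option maxSynthPendingDepth 3

namespace LipFree

section Ideals

variable {X : Type*} [MetricSpace X]

/-- `B_θ(F)`, the union of the closed balls of radius `θ` centred at the points of the finite
set `F`, as a closed set. -/
def finBall (θ : ℝ) (F : Finset X) : Closeds X :=
  ⟨⋃ p ∈ F, Metric.closedBall p θ,
    F.finite_toSet.isClosed_biUnion fun _ _ => Metric.isClosed_closedBall⟩

lemma finBall_mono {θ θ' : ℝ} (h : θ ≤ θ') (F : Finset X) : finBall θ F ≤ finBall θ' F := by
  intro x hx
  simp only [finBall, Closeds.coe_mk, ← SetLike.mem_coe, Set.mem_iUnion,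
    Metric.mem_closedBall, exists_prop] at hx ⊢
  obtain ⟨p, hp, hxp⟩ := hx
  exact ⟨p, hp, hxp.trans h⟩

/-- The ideal `𝓕` of finite subsets of `X` (an ideal of closed subsets is an order ideal of the
lattice `Closeds X`). -/
def finIdeal (X : Type*) [MetricSpace X] : Order.Ideal (Closeds X) where
  carrier := {A | (A : Set X).Finite}
  lower' _ _ hBA hA := Set.Finite.subset hA hBA
  nonempty' := ⟨⊥, by simp⟩
  directed' A hA B hB := ⟨A ⊔ B, by
    simpa using Set.Finite.union hA hB, le_sup_left, le_sup_right⟩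

/-- `ulm(I)`: the closed sets that are uniformly locally modeled on the ideal `I`. -/
def ulm (I : Order.Ideal (Closeds X)) : Order.Ideal (Closeds X) where
  carrier := {E | ∃ θ : ℝ, 0 < θ ∧ ∀ F : Finset X, E ⊓ finBall θ F ∈ I}
  lower' _ _ hBA := fun ⟨θ, hθ, h⟩ =>
    ⟨θ, hθ, fun F => I.lower (inf_le_inf_right _ hBA) (h F)⟩
  nonempty' := ⟨⊥, 1, one_pos, fun F => by simp⟩
  directed' := by
    rintro A ⟨θ, hθ, h⟩ B ⟨θ', hθ', h'⟩
    refine ⟨A ⊔ B, ⟨min θ θ', lt_min hθ hθ', fun F => ?_⟩, le_sup_left, le_sup_right⟩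
    rw [inf_sup_right]
    exact Order.Ideal.sup_mem
      (I.lower (inf_le_inf_left _ (finBall_mono (min_le_left _ _) F)) (h F))
      (I.lower (inf_le_inf_left _ (finBall_mono (min_le_right _ _) F)) (h' F))

lemma le_ulm (I : Order.Ideal (Closeds X)) : I ≤ ulm I := fun _ hE =>
  ⟨1, one_pos, fun _ => I.lower inf_le_left hE⟩

end Ideals

section Lip

variable {X : Type*} [MetricSpace X]

/-- The space `Lip(X)` of real Lipschitz functions on `X` that vanish at the basepoint `o`. -/
@[ext]
structure Lip (o : X) where
  toFun : X → ℝ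
  base' : toFun o = 0
  lipschitz' : ∃ K, LipschitzWith K toFun

variable {o : X}

namespace Lip

instance : CoeFun (Lip o) (fun _ => X → ℝ) := ⟨Lip.toFun⟩

lemma base (f : Lip o) : f o = 0 := f.base'

instance : Zero (Lip o) := ⟨⟨fun _ => 0, rfl, 0, LipschitzWith.const 0⟩⟩

instance : Add (Lip o) := ⟨fun f g => ⟨fun p => f p + g p, by simp [base], by
  obtain ⟨K, hK⟩ := f.lipschitz'
  obtain ⟨L, hL⟩ := g.lipschitz'
  exact ⟨K + L, hK.add hL⟩⟩⟩

instance : Neg (Lip o) := ⟨fun f => ⟨fun p => -f p, by simp [base], by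
  obtain ⟨K, hK⟩ := f.lipschitz'
  exact ⟨K, hK.neg⟩⟩⟩

instance : SMul ℝ (Lip o) := ⟨fun c f => ⟨fun p => c * f p, by simp [base], by
  obtain ⟨K, hK⟩ := f.lipschitz'
  exact ⟨‖c‖₊ * K, (lipschitzWith_smul c).comp hK⟩⟩⟩

@[simp] lemma zero_apply (p : X) : (0 : Lip o) p = 0 := rfl
@[simp] lemma add_apply (f g : Lip o) (p : X) : (f + g) p = f p + g p := rfl
@[simp] lemma neg_apply (f : Lip o) (p : X) : (-f) p = -f p := rfl
@[simp] lemma smul_apply (c : ℝ) (f : Lip o) (p : X) : (c • f) p = c * f p := rfl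

lemma ext_apply {f g : Lip o} (h : ∀ p, f p = g p) : f = g := Lip.ext (funext h)

/-- The additive group structure underlying the normed space structure below. -/
@[reducible] def addCommGroup (o : X) : AddCommGroup (Lip o) where
  add_assoc _ _ _ := ext_apply fun _ => add_assoc _ _ _
  zero_add _ := ext_apply fun _ => zero_add _
  add_zero _ := ext_apply fun _ => add_zero _
  nsmul := nsmulRec
  zsmul := zsmulRec
  neg_add_cancel _ := ext_apply fun _ => neg_add_cancel _
  add_comm _ _ := ext_apply fun _ => add_comm _ _

end Lip

/-- The Lipschitz norm `sup_{p ≠ q} |f p - f q| / d(p,q)` (the pairs `p = q` contribute `0`). -/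
noncomputable def lipNorm (f : Lip o) : ℝ := ⨆ x : X × X, |f x.1 - f x.2| / dist x.1 x.2

lemma lipNorm_bdd (f : Lip o) :
    BddAbove (Set.range fun x : X × X => |f x.1 - f x.2| / dist x.1 x.2) := by
  obtain ⟨K, hK⟩ := f.lipschitz'
  refine ⟨K, ?_⟩
  rintro _ ⟨x, rfl⟩
  exact div_le_of_le_mul₀ dist_nonneg K.2 (hK.dist_le_mul x.1 x.2)

lemma lipNorm_nonneg (f : Lip o) : 0 ≤ lipNorm f :=
  Real.iSup_nonneg fun _ => div_nonneg (abs_nonneg _) dist_nonneg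

lemma abs_sub_le_lipNorm (f : Lip o) (p q : X) : |f p - f q| ≤ lipNorm f * dist p q := by
  rcases eq_or_ne p q with rfl | h
  · simp
  · rw [← div_le_iff₀ (dist_pos.2 h)]
    exact le_ciSup (lipNorm_bdd f) (p, q)

lemma lipNorm_le {f : Lip o} {C : ℝ} (hC : 0 ≤ C) (h : ∀ p q, |f p - f q| ≤ C * dist p q) :
    lipNorm f ≤ C :=
  Real.iSup_le (fun x => div_le_of_le_mul₀ dist_nonneg hC (h x.1 x.2)) hC

noncomputable instance : NormedAddCommGroup (Lip o) :=
  letI := Lip.addCommGroup o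
  AddGroupNorm.toNormedAddCommGroup
    { toFun := lipNorm
      map_zero' := le_antisymm (lipNorm_le le_rfl (by simp)) (lipNorm_nonneg _)
      add_le' := fun f g => lipNorm_le (add_nonneg (lipNorm_nonneg f) (lipNorm_nonneg g))
        fun p q => by
          have hf := abs_sub_le_lipNorm f p q
          have hg := abs_sub_le_lipNorm g p q
          have := abs_add_le (f p - f q) (g p - g q)
          simp only [Lip.add_apply]
          rw [add_sub_add_comm, add_mul]
          linarith
      neg' := fun f => by
        unfold lipNorm
        congr 1
        funext x
        simp only [Lip.neg_apply]
        rw [← abs_neg]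
        congr 2
        ring
      eq_zero_of_map_eq_zero' := fun f hf => by
        refine Lip.ext_apply fun p => ?_
        have := abs_sub_le_lipNorm f p o
        rw [hf, f.base, zero_mul, sub_zero] at this
        simpa using this }

lemma Lip.norm_def (f : Lip o) : ‖f‖ = lipNorm f := rfl

noncomputable instance : NormedSpace ℝ (Lip o) where
  one_smul _ := Lip.ext_apply fun _ => one_mul _
  mul_smul _ _ _ := Lip.ext_apply fun _ => mul_assoc _ _ _
  smul_zero _ := Lip.ext_apply fun _ => mul_zero _
  smul_add _ _ _ := Lip.ext_apply fun _ => mul_add _ _ _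
  add_smul _ _ _ := Lip.ext_apply fun _ => add_mul _ _ _
  zero_smul _ := Lip.ext_apply fun _ => zero_mul _
  norm_smul_le c f := lipNorm_le (mul_nonneg (norm_nonneg c) (lipNorm_nonneg f)) fun p q => by
    rw [Lip.smul_apply, Lip.smul_apply, ← mul_sub, abs_mul, mul_assoc]
    exact mul_le_mul_of_nonneg_left (abs_sub_le_lipNorm f p q) (abs_nonneg c)

/-- `supp f`, the closure of `{x | f x ≠ 0}`. -/
def supp (f : Lip o) : Closeds X := ⟨tsupport (f : X → ℝ), isClosed_tsupport _⟩

/-- `Lip_I(X)`: the subspace of all `f` in `Lip(X)` with `supp f ∈ I`, with the norm of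
`Lip(X)`. -/
def LipI (o : X) (I : Order.Ideal (Closeds X)) : Submodule ℝ (Lip o) where
  carrier := {f | supp f ∈ I}
  zero_mem' := by
    have h : supp (0 : Lip o) = ⊥ := by
      ext x
      change x ∈ tsupport (fun _ : X => (0 : ℝ)) ↔ x ∈ (∅ : Set X)
      simp [tsupport]
    change supp (0 : Lip o) ∈ I
    rw [h]
    exact I.bot_mem
  add_mem' {f g} hf hg := I.lower (a := supp f ⊔ supp g)
    (tsupport_add (f : X → ℝ) (g : X → ℝ)) (Order.Ideal.sup_mem hf hg)
  smul_mem' c f hf := I.lower (a := supp f)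
    (closure_mono fun x hx h => hx (by simp [h])) hf

/-- The functional `δ_p : f ↦ f p` on `Lip_I(X)`. -/
noncomputable def delta (o : X) (I : Order.Ideal (Closeds X)) (p : X) :
    StrongDual ℝ (LipI o I) :=
  LinearMap.mkContinuous
    { toFun := fun f => (f : Lip o) p
      map_add' := fun _ _ => rfl
      map_smul' := fun _ _ => rfl }
    (dist p o) fun f => by
      have := abs_sub_le_lipNorm (f : Lip o) p o
      rw [Lip.base, sub_zero, mul_comm] at this
      exact this

@[simp] lemma delta_apply (o : X) (I : Order.Ideal (Closeds X)) (p : X) (f : LipI o I) :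
    delta o I p f = (f : Lip o) p := rfl

/-- `ℱ_I(X)`: the closure, in the dual of `Lip_I(X)`, of the linear span of `{δ_p | p ∈ X}`,
with the dual norm. -/
noncomputable def FreeI (o : X) (I : Order.Ideal (Closeds X)) :
    Submodule ℝ (StrongDual ℝ (LipI o I)) :=
  (Submodule.span ℝ (Set.range (delta o I))).topologicalClosure

/-- The inclusion `Lip_I(X) ⊆ Lip_J(X)` for ideals `I ⊆ J`. -/
noncomputable def inclLip (o : X) {I J : Order.Ideal (Closeds X)} (h : I ≤ J) :
    LipI o I →L[ℝ] LipI o J :=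
  LinearMap.mkContinuous (Submodule.inclusion fun _ hf => h hf) 1 fun f => by
    rw [one_mul]
    exact le_rfl

/-- Restriction of functionals from `Lip_J(X)` to `Lip_I(X)`, for ideals `I ⊆ J`. -/
noncomputable def restrDual (o : X) {I J : Order.Ideal (Closeds X)} (h : I ≤ J) :
    StrongDual ℝ (LipI o J) →L[ℝ] StrongDual ℝ (LipI o I) :=
  ContinuousLinearMap.precomp ℝ (inclLip o h)

@[simp] lemma restrDual_apply (o : X) {I J : Order.Ideal (Closeds X)} (h : I ≤ J)
    (v : StrongDual ℝ (LipI o J)) (f : LipI o I) : restrDual o h v f = v (inclLip o h f) := rfl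

lemma restrDual_delta (o : X) {I J : Order.Ideal (Closeds X)} (h : I ≤ J) (p : X) :
    restrDual o h (delta o J p) = delta o I p := rfl

lemma restrDual_mem (o : X) {I J : Order.Ideal (Closeds X)} (h : I ≤ J)
    {v : StrongDual ℝ (LipI o J)} (hv : v ∈ FreeI o J) : restrDual o h v ∈ FreeI o I := by
  have hmaps : Set.MapsTo (restrDual o h) (Submodule.span ℝ (Set.range (delta o J)))
      (Submodule.span ℝ (Set.range (delta o I))) := by
    intro w hw
    induction hw using Submodule.span_induction with
    | mem w hw =>
      obtain ⟨p, rfl⟩ := hw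
      exact Submodule.subset_span ⟨p, rfl⟩
    | zero => simp
    | add x y _ _ hx hy => rw [map_add]; exact Submodule.add_mem _ hx hy
    | smul c x _ hx => rw [map_smul]; exact Submodule.smul_mem _ c hx
  exact hmaps.closure (restrDual o h).continuous hv

/-- The restriction map `R^J_I : ℱ_J(X) → ℱ_I(X)` for ideals `I ⊆ J`: the continuous linear map
with `δ_p ↦ δ_p`. -/
noncomputable def R (o : X) {I J : Order.Ideal (Closeds X)} (h : I ≤ J) :
    FreeI o J →L[ℝ] FreeI o I :=
  ((restrDual o h).comp (FreeI o J).subtypeL).codRestrict (FreeI o I)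
    fun v => restrDual_mem o h v.2

end Lip

open scoped Pointwise in
/-- `T` is a `K`-semi-embedding, for `K ∈ [1, ∞)`. -/
def IsSemiEmbedding {V W : Type*} [NormedAddCommGroup V] [NormedSpace ℝ V]
    [NormedAddCommGroup W] [NormedSpace ℝ W] (K : ℝ) (T : V →L[ℝ] W) : Prop :=
  1 ≤ K ∧ Function.Injective T ∧
    closure (T '' Metric.closedBall 0 1) ⊆ T '' (K • Metric.closedBall (0 : V) 1)

end LipFree

/-! An element of the span of the evaluations sees only finitely many points. If `E ⊓ finBall θ F ∈
I` for all `F`, a function supported in `E` may therefore be multiplied by a cutoff around those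
points, which puts it in `Lip_I` at the cost of a factor `1 + 1/θ`. Hence on functions supported in
a fixed `E ∈ ulm I`, elements of `ℱ_J` are controlled by their restrictions (`abs_apply_le`), and
injectivity is immediate. For the semi-embedding, let `v n` lie in the unit ball of `ℱ_J` with
restrictions converging in norm. The same estimate makes `v n` converge pointwise to a functional
`u` of norm at most 1. The difficulty is that `u ∈ ℱ_J`, since pointwise limits may leave a norm
closure. But `u` is tame, and a gliding hump argument using the lattice operations of `Lip_J` makes
tameness uniform in the support; Hahn-Banach then gives `u ∈ ℱ_J` (`IsTame.mem_freeI`). The lift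
lies in `B` itself, so the constant 7 is not sharp. -/

namespace LipFree

/-! ### Lattice operations on Lipschitz functions -/

section Lattice

variable {X : Type*} [MetricSpace X] {o : X}

lemma Lip.abs_sub_le (f : Lip o) (p q : X) : |f p - f q| ≤ ‖f‖ * dist p q :=
  abs_sub_le_lipNorm f p q

lemma Lip.norm_le {f : Lip o} {C : ℝ} (hC : 0 ≤ C) (h : ∀ p q, |f p - f q| ≤ C * dist p q) :
    ‖f‖ ≤ C := lipNorm_le hC h

/-- The element of `Lip(X)` given by a function that satisfies a Lipschitz estimate. -/
def Lip.ofLe (g : X → ℝ) (hg : g o = 0) (C : ℝ) (h : ∀ p q, |g p - g q| ≤ C * dist p q) :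
    Lip o :=
  ⟨g, hg, C.toNNReal, LipschitzWith.of_dist_le_mul fun p q =>
    (h p q).trans (mul_le_mul_of_nonneg_right (Real.le_coe_toNNReal C) dist_nonneg)⟩

@[simp] lemma Lip.ofLe_apply (g : X → ℝ) (hg : g o = 0) (C : ℝ)
    (h : ∀ p q, |g p - g q| ≤ C * dist p q) (p : X) : Lip.ofLe g hg C h p = g p := rfl

lemma supp_le {f : Lip o} {E : Closeds X} (h : ∀ p, f p ≠ 0 → p ∈ E) : supp f ≤ E :=
  closure_minimal (fun p hp => h p hp) E.isClosed

lemma mem_supp {f : Lip o} {p : X} (h : f p ≠ 0) : p ∈ supp f :=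
  subset_tsupport (f : X → ℝ) h

lemma max_estimate (f g : Lip o) (p q : X) :
    |max (f p) (g p) - max (f q) (g q)| ≤ max ‖f‖ ‖g‖ * dist p q := by
  refine (abs_max_sub_max_le_max _ _ _ _).trans (max_le ?_ ?_)
  · exact (f.abs_sub_le p q).trans (by gcongr; exact le_max_left _ _)
  · exact (g.abs_sub_le p q).trans (by gcongr; exact le_max_right _ _)

lemma min_estimate (f g : Lip o) (p q : X) :
    |min (f p) (g p) - min (f q) (g q)| ≤ max ‖f‖ ‖g‖ * dist p q := by
  refine (abs_min_sub_min_le_max _ _ _ _).trans (max_le ?_ ?_)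
  · exact (f.abs_sub_le p q).trans (by gcongr; exact le_max_left _ _)
  · exact (g.abs_sub_le p q).trans (by gcongr; exact le_max_right _ _)

variable {I : Order.Ideal (Closeds X)}

/-- The pointwise maximum of two functions in `Lip_I(X)`. -/
noncomputable def LipI.sup (f g : LipI o I) : LipI o I :=
  ⟨Lip.ofLe (fun p => max ((f : Lip o) p) ((g : Lip o) p)) (by simp [Lip.base]) _
      (max_estimate (f : Lip o) (g : Lip o)),
    I.lower (supp_le (E := supp (f : Lip o) ⊔ supp (g : Lip o)) fun p hp => by
      by_cases hf : (f : Lip o) p = 0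
      · by_cases hg : (g : Lip o) p = 0
        · exact absurd (by simp [hf, hg]) hp
        · exact Or.inr (mem_supp hg)
      · exact Or.inl (mem_supp hf)) (Order.Ideal.sup_mem f.2 g.2)⟩

/-- The pointwise minimum of two functions in `Lip_I(X)`. -/
noncomputable def LipI.inf (f g : LipI o I) : LipI o I :=
  ⟨Lip.ofLe (fun p => min ((f : Lip o) p) ((g : Lip o) p)) (by simp [Lip.base]) _
      (min_estimate (f : Lip o) (g : Lip o)),
    I.lower (supp_le (E := supp (f : Lip o) ⊔ supp (g : Lip o)) fun p hp => by
      by_cases hf : (f : Lip o) p = 0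
      · by_cases hg : (g : Lip o) p = 0
        · exact absurd (by simp [hf, hg]) hp
        · exact Or.inr (mem_supp hg)
      · exact Or.inl (mem_supp hf)) (Order.Ideal.sup_mem f.2 g.2)⟩

@[simp] lemma LipI.sup_apply (f g : LipI o I) (p : X) :
    (LipI.sup f g : Lip o) p = max ((f : Lip o) p) ((g : Lip o) p) := rfl

@[simp] lemma LipI.inf_apply (f g : LipI o I) (p : X) :
    (LipI.inf f g : Lip o) p = min ((f : Lip o) p) ((g : Lip o) p) := rfl

lemma LipI.norm_sup_le (f g : LipI o I) : ‖LipI.sup f g‖ ≤ max ‖f‖ ‖g‖ :=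
  Lip.norm_le (le_max_of_le_left (norm_nonneg _)) (max_estimate (f : Lip o) (g : Lip o))

lemma LipI.norm_inf_le (f g : LipI o I) : ‖LipI.inf f g‖ ≤ max ‖f‖ ‖g‖ :=
  Lip.norm_le (le_max_of_le_left (norm_nonneg _)) (min_estimate (f : Lip o) (g : Lip o))

lemma LipI.sup_add_inf (f g : LipI o I) : LipI.sup f g + LipI.inf f g = f + g :=
  Subtype.ext (Lip.ext_apply fun _ => max_add_min _ _)

lemma LipI.sup_zero_sub (f : LipI o I) : LipI.sup f 0 - LipI.sup (-f) 0 = f := by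
  rw [sub_eq_iff_eq_add]
  refine Subtype.ext (Lip.ext_apply fun p => ?_)
  change max ((f : Lip o) p) 0 = (f : Lip o) p + max (-(f : Lip o) p) 0
  rcases le_total ((f : Lip o) p) 0 with h | h
  · rw [max_eq_right h, max_eq_left (by linarith)]; ring
  · rw [max_eq_left h, max_eq_right (by linarith)]; ring

end Lattice

/-! ### Cutoffs and control by restrictions -/

section Cutoff

variable {X : Type*} [MetricSpace X] {o : X}

lemma Lip.abs_le_norm (ho : ∀ p : X, dist p o ≤ 1) (f : Lip o) (p : X) : |f p| ≤ ‖f‖ := by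
  have h := f.abs_sub_le p o
  rw [f.base, sub_zero] at h
  exact h.trans (mul_le_of_le_one_right (norm_nonneg _) (ho p))

/-- Multiplication by a Lipschitz cutoff at scale `θ` around a finite set. -/
lemma exists_cutoff (ho : ∀ p : X, dist p o ≤ 1) {I : Order.Ideal (Closeds X)} {E : Closeds X}
    {θ : ℝ} (hθ : 0 < θ) (hE : ∀ F : Finset X, E ⊓ finBall θ F ∈ I) (F : Finset X)
    (f : Lip o) (hf : supp f ≤ E) :
    ∃ g : LipI o I, ‖g‖ ≤ (1 + 1 / θ) * ‖f‖ ∧ ∀ p ∈ F, (g : Lip o) p = f p := by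
  classical
  -- Adding the basepoint keeps `S` nonempty: `infDist` to `∅` is 0, which would give `φ = 1`
  -- everywhere.
  set S : Set X := ↑(insert o F) with hS
  have hSne : S.Nonempty := ⟨o, by simp [hS]⟩
  let φ : X → ℝ := fun p => max 0 (1 - Metric.infDist p S / θ)
  have hφ0 : ∀ p, 0 ≤ φ p := fun p => le_max_left _ _
  have hφ1 : ∀ p, φ p ≤ 1 := fun p =>
    max_le zero_le_one (sub_le_self _ (div_nonneg Metric.infDist_nonneg hθ.le))
  have hφS : ∀ p ∈ S, φ p = 1 := fun p hp => by simp [φ, Metric.infDist_zero_of_mem hp]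
  have hφL : ∀ p q, |φ p - φ q| ≤ 1 / θ * dist p q := fun p q => by
    have h1 : |Metric.infDist p S - Metric.infDist q S| ≤ dist p q := by
      simpa [Real.dist_eq] using (Metric.lipschitz_infDist_pt S).dist_le_mul p q
    have h2 := abs_max_sub_max_le_max 0 (1 - Metric.infDist p S / θ) 0
      (1 - Metric.infDist q S / θ)
    refine h2.trans (max_le (by simpa using by positivity) ?_)
    have h3 : 1 - Metric.infDist p S / θ - (1 - Metric.infDist q S / θ) =
        -(1 / θ * (Metric.infDist p S - Metric.infDist q S)) := by ring
    rw [h3, abs_neg, abs_mul, abs_of_pos (by positivity : 0 < 1 / θ)]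
    gcongr
  have hest : ∀ p q, |f p * φ p - f q * φ q| ≤ (1 + 1 / θ) * ‖f‖ * dist p q := fun p q => by
    have h3 : f p * φ p - f q * φ q = (f p - f q) * φ p + f q * (φ p - φ q) := by ring
    rw [h3]
    refine (abs_add_le _ _).trans ?_
    rw [abs_mul, abs_mul, abs_of_nonneg (hφ0 p)]
    have h4 : |f p - f q| * φ p ≤ ‖f‖ * dist p q :=
      (mul_le_of_le_one_right (abs_nonneg _) (hφ1 p)).trans (f.abs_sub_le p q)
    have h5 : |f q| * |φ p - φ q| ≤ ‖f‖ * (1 / θ * dist p q) :=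
      mul_le_mul (f.abs_le_norm ho q) (hφL p q) (abs_nonneg _) (norm_nonneg _)
    linarith
  refine ⟨⟨Lip.ofLe (fun p => f p * φ p) (by simp [Lip.base]) _ hest,
    I.lower (supp_le fun p hp => ?_) (hE (insert o F))⟩,
    Lip.norm_le (by positivity) hest, fun p hp => ?_⟩
  · have hfp : f p ≠ 0 := left_ne_zero_of_mul hp
    have hφp : φ p ≠ 0 := right_ne_zero_of_mul hp
    refine ⟨hf (mem_supp hfp), ?_⟩
    -- The distance to the finite set is attained, so `φ p ≠ 0` places `p` in a single ball of
    -- radius `θ`.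
    obtain ⟨y, hy, hpy⟩ := (insert o F).finite_toSet.isCompact.exists_infDist_eq_dist hSne p
    have h6 : Metric.infDist p S < θ := by
      by_contra! hcon
      refine hφp (max_eq_left ?_)
      rw [sub_nonpos, one_le_div hθ]
      exact hcon
    change p ∈ ⋃ x ∈ insert o F, Metric.closedBall x θ
    refine Set.mem_biUnion (Finset.mem_coe.1 hy) ?_
    rw [Metric.mem_closedBall, ← hpy]
    exact h6.le
  · simp [hφS p (by simp [hS, hp])]

/-- An element of the span of the evaluations depends on finitely many values only. -/
lemma exists_finset_of_mem_span {J : Order.Ideal (Closeds X)} {u : StrongDual ℝ (LipI o J)}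
    (hu : u ∈ Submodule.span ℝ (Set.range (delta o J))) :
    ∃ F : Finset X, ∀ f : LipI o J, (∀ p ∈ F, (f : Lip o) p = 0) → u f = 0 := by
  classical
  induction hu using Submodule.span_induction with
  | mem w hw =>
    obtain ⟨p, rfl⟩ := hw
    exact ⟨{p}, fun f hf => hf p (by simp)⟩
  | zero => exact ⟨∅, by simp⟩
  | add x y _ _ hx hy =>
    obtain ⟨F, hF⟩ := hx
    obtain ⟨G, hG⟩ := hy
    refine ⟨F ∪ G, fun f hf => ?_⟩
    rw [add_apply, hF f fun p hp => hf p (Finset.mem_union_left _ hp),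
      hG f fun p hp => hf p (Finset.mem_union_right _ hp), add_zero]
  | smul c x _ hx =>
    obtain ⟨F, hF⟩ := hx
    refine ⟨F, fun f hf => ?_⟩
    rw [smul_apply, hF f hf, smul_zero]

/-- On functions supported in a fixed member of `J`, the elements of `ℱ_J(X)` are controlled by
their restrictions to `Lip_I(X)`. -/
lemma abs_apply_le (ho : ∀ p : X, dist p o ≤ 1) {I J : Order.Ideal (Closeds X)} (h : I ≤ J)
    {E : Closeds X} {θ : ℝ} (hθ : 0 < θ) (hE : ∀ F : Finset X, E ⊓ finBall θ F ∈ I)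
    (f : LipI o J) (hf : supp (f : Lip o) ≤ E) {u : StrongDual ℝ (LipI o J)}
    (hu : u ∈ FreeI o J) :
    |u f| ≤ ‖restrDual o h u‖ * ((1 + 1 / θ) * ‖f‖) := by
  have hcl : IsClosed {u : StrongDual ℝ (LipI o J) |
      |u f| ≤ ‖restrDual o h u‖ * ((1 + 1 / θ) * ‖f‖)} :=
    isClosed_le (by fun_prop) (by fun_prop)
  -- Both sides are continuous in `u`, and the constant does not depend on `F`, so the span
  -- suffices.
  refine closure_minimal (fun u hu => ?_) hcl hu
  obtain ⟨F, hF⟩ := exists_finset_of_mem_span hu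
  obtain ⟨g, hg, hgF⟩ := exists_cutoff ho hθ hE F (f : Lip o) hf
  have h1 : u (f - inclLip o h g) = 0 := hF _ fun p hp => by
    change (f : Lip o) p + -(g : Lip o) p = 0
    rw [hgF p hp, add_neg_cancel]
  rw [map_sub, sub_eq_zero] at h1
  change |u f| ≤ _
  rw [h1]
  exact ((restrDual o h u).le_opNorm g).trans (by gcongr; exact hg)

end Cutoff

/-! ### Tame functionals and the gliding hump -/

section Tame

variable {X : Type*} [MetricSpace X] {o : X} {J : Order.Ideal (Closeds X)}

/-- A functional on `Lip_J(X)` is tame if, on the functions supported in a fixed member of `J`,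
it is small on the unit ball of those that vanish on a large finite set. -/
def IsTame (v : StrongDual ℝ (LipI o J)) : Prop :=
  ∀ E ∈ J, ∀ ε : ℝ, 0 < ε → ∃ F : Finset X, ∀ g : LipI o J, supp (g : Lip o) ≤ E → ‖g‖ ≤ 1 →
    (∀ p ∈ F, (g : Lip o) p = 0) → |v g| ≤ ε

lemma IsTame.neg {v : StrongDual ℝ (LipI o J)} (hv : IsTame v) : IsTame (-v) := by
  intro E hE ε hε
  obtain ⟨F, hF⟩ := hv E hE ε hε
  exact ⟨F, fun g h1 h2 h3 => by simpa using hF g h1 h2 h3⟩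

/-- The gliding hump argument: pointwise maxima of humps stay in the unit ball. -/
lemma IsTame.exists_finset_le {v : StrongDual ℝ (LipI o J)} (hv : IsTame v) {δ : ℝ}
    (hδ : 0 < δ) :
    ∃ F : Finset X, ∀ g : LipI o J, (∀ p, 0 ≤ (g : Lip o) p) → ‖g‖ ≤ 1 →
      (∀ p ∈ F, (g : Lip o) p = 0) → v g ≤ δ := by
  by_contra! hcon
  have key : ∀ N : ℕ, ∃ h : LipI o J, (∀ p, 0 ≤ (h : Lip o) p) ∧ ‖h‖ ≤ 1 ∧
      N * (δ / 2) ≤ v h := by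
    intro N
    induction N with
    | zero => exact ⟨0, fun p => le_rfl, by simp, by simp⟩
    | succ N ih =>
      obtain ⟨h, h0, h1, hN⟩ := ih
      -- The overlap `h ∧ g` with the next hump is supported in `supp h` and vanishes on `F`, so it
      -- costs at most `δ / 2`, while `g` gains more than `δ`.
      obtain ⟨F, hF⟩ := hv (supp (h : Lip o)) h.2 (δ / 2) (by positivity)
      obtain ⟨g, g0, g1, gF, hg⟩ := hcon F
      refine ⟨LipI.sup h g, fun p => le_max_of_le_left (h0 p),
        (LipI.norm_sup_le h g).trans (max_le h1 g1), ?_⟩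
      have hinf : |v (LipI.inf h g)| ≤ δ / 2 := by
        refine hF _ (supp_le fun p hp => mem_supp fun hz => hp ?_)
          ((LipI.norm_inf_le h g).trans (max_le h1 g1)) fun p hp => ?_
        · rw [LipI.inf_apply, hz, min_eq_left (g0 p)]
        · rw [LipI.inf_apply, gF p hp, min_eq_right (h0 p)]
      have hsum : v (LipI.sup h g) + v (LipI.inf h g) = v h + v g := by
        rw [← map_add, LipI.sup_add_inf, map_add]
      have := le_abs_self (v (LipI.inf h g))
      push_cast
      linarith
  obtain ⟨N, hN⟩ := exists_nat_gt (‖v‖ / (δ / 2))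
  obtain ⟨h, -, h1, hv'⟩ := key N
  rw [div_lt_iff₀ (by positivity)] at hN
  have h2 : v h ≤ ‖v‖ * 1 := (le_abs_self _).trans ((v.le_opNorm h).trans (by gcongr))
  linarith

/-- Apply the one-sided bound to `v` on the positive part and to `-v` on the negative part, then
rescale. -/
lemma IsTame.exists_finset_abs_le {v : StrongDual ℝ (LipI o J)} (hv : IsTame v) {δ : ℝ}
    (hδ : 0 < δ) :
    ∃ F : Finset X, ∀ g : LipI o J, (∀ p ∈ F, (g : Lip o) p = 0) → |v g| ≤ δ * ‖g‖ := by
  classical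
  obtain ⟨F, hF⟩ := hv.exists_finset_le (half_pos hδ)
  obtain ⟨G, hG⟩ := hv.neg.exists_finset_le (half_pos hδ)
  have key : ∀ g : LipI o J, (∀ p ∈ F ∪ G, (g : Lip o) p = 0) → ‖g‖ ≤ 1 → v g ≤ δ := by
    intro g hg h1
    have hn : ∀ f : LipI o J, ‖f‖ ≤ 1 → ‖LipI.sup f 0‖ ≤ 1 := fun f hf =>
      (LipI.norm_sup_le f 0).trans (max_le hf (by simp))
    have a1 := hF (LipI.sup g 0) (fun p => le_max_right _ _) (hn g h1) fun p hp => by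
      rw [LipI.sup_apply, hg p (Finset.mem_union_left _ hp)]; exact max_self _
    have a2 := hG (LipI.sup (-g) 0) (fun p => le_max_right _ _) (hn (-g) (by rwa [norm_neg]))
      fun p hp => by
        change max (-(g : Lip o) p) 0 = 0
        rw [hg p (Finset.mem_union_right _ hp), neg_zero, max_self]
    have a3 : v g = v (LipI.sup g 0) - v (LipI.sup (-g) 0) := by
      rw [← map_sub, LipI.sup_zero_sub]
    rw [neg_apply] at a2
    linarith
  have hle : ∀ g : LipI o J, (∀ p ∈ F ∪ G, (g : Lip o) p = 0) → v g ≤ δ * ‖g‖ := by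
    intro g hg
    rcases eq_or_ne g 0 with rfl | hne
    · simp
    have hpos : 0 < ‖g‖ := norm_pos_iff.2 hne
    have := key (‖g‖⁻¹ • g) (fun p hp => by
      change ‖g‖⁻¹ * (g : Lip o) p = 0
      rw [hg p hp, mul_zero]) (by
        rw [norm_smul, norm_inv, norm_norm, inv_mul_cancel₀ hpos.ne'])
    rwa [map_smul, smul_eq_mul, inv_mul_le_iff₀ hpos, mul_comm] at this
  refine ⟨F ∪ G, fun g hg => abs_le'.2 ⟨hle g hg, ?_⟩⟩
  have := hle (-g) fun p hp => by
    change -(g : Lip o) p = 0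
    rw [hg p hp, neg_zero]
  rwa [map_neg, norm_neg] at this

/-- On the functions vanishing on a large finite `F`, `v` has small norm. A Hahn-Banach extension
`s` of that restriction is small, and `v - s` kills the common kernel of the `δ_p`, `p ∈ F`, so it
is a combination of them. -/
lemma IsTame.mem_freeI {v : StrongDual ℝ (LipI o J)} (hv : IsTame v) : v ∈ FreeI o J := by
  refine Metric.mem_closure_iff.2 fun ε hε => ?_
  obtain ⟨F, hF⟩ := hv.exists_finset_abs_le (half_pos hε)
  let N : Submodule ℝ (LipI o J) := ⨅ p : F, LinearMap.ker (delta o J p).toLinearMap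
  have hN : ∀ g ∈ N, ∀ p ∈ F, (g : Lip o) p = 0 := fun g hg p hp => by
    have := (Submodule.mem_iInf _).1 hg ⟨p, hp⟩
    exact this
  obtain ⟨s, hs, hsn⟩ := exists_extension_norm_eq N (v.comp N.subtypeL)
  have hnorm : ‖s‖ ≤ ε / 2 := by
    rw [hsn]
    exact ContinuousLinearMap.opNorm_le_bound _ (half_pos hε).le fun g => hF g (hN g g.2)
  have hspan : (v - s).toLinearMap ∈
      Submodule.span ℝ (Set.range fun p : F => (delta o J p).toLinearMap) := by
    refine mem_span_of_iInf_ker_le_ker fun g hg => ?_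
    have : s g = v g := hs ⟨g, hg⟩
    change v g - s g = 0
    rw [this, sub_self]
  refine ⟨v - s, ?_, ?_⟩
  · obtain ⟨c, hc⟩ := (Submodule.mem_span_range_iff_exists_fun ℝ).1 hspan
    have : v - s = ∑ p : F, c p • delta o J p := by
      ext g
      have := LinearMap.congr_fun hc g
      simpa using this.symm
    rw [this]
    exact Submodule.sum_mem _ fun p _ => Submodule.smul_mem _ _ (Submodule.subset_span ⟨_, rfl⟩)
  · rw [dist_eq_norm, sub_sub_cancel]
    linarith

end Tame

/-! ### Injectivity and lifting of limits -/

section SemiEmbedding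

variable {X : Type*} [MetricSpace X] {o : X}

lemma R_ulm_injective (ho : ∀ p : X, dist p o ≤ 1) (I : Order.Ideal (Closeds X)) :
    Function.Injective (R o (le_ulm I)) := by
  rw [injective_iff_map_eq_zero]
  intro u hu
  have hu' : restrDual o (le_ulm I) (u : StrongDual ℝ (LipI o (ulm I))) = 0 :=
    congrArg Subtype.val hu
  refine Subtype.ext (ContinuousLinearMap.ext fun f => ?_)
  obtain ⟨θ, hθ, hE⟩ := f.2
  have := abs_apply_le ho (le_ulm I) hθ hE f le_rfl u.2
  rw [hu', norm_zero, zero_mul] at this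
  simpa using this

open Filter Topology in
/-- Norm limits in `ℱ_I(X)` of a bounded sequence of `ℱ_J(X)`, for `J = ulm(I)`, lift to `ℱ_J(X)`
without increase of the bound. -/
lemma exists_lift (ho : ∀ p : X, dist p o ≤ 1) {I : Order.Ideal (Closeds X)} {C : ℝ}
    {w : FreeI o I} {v : ℕ → FreeI o (ulm I)} (hv : ∀ n, ‖v n‖ ≤ C)
    (hlim : Tendsto (fun n => R o (le_ulm I) (v n)) atTop (𝓝 w)) :
    ∃ u : FreeI o (ulm I), ‖u‖ ≤ C ∧ R o (le_ulm I) u = w := by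
  have hC : 0 ≤ C := (norm_nonneg _).trans (hv 0)
  have hlim' : Tendsto (fun n => restrDual o (le_ulm I) (v n : StrongDual ℝ (LipI o (ulm I))))
      atTop (𝓝 (w : StrongDual ℝ (LipI o I))) :=
    (continuous_subtype_val.tendsto w).comp hlim
  have hbound : ∀ E ∈ ulm I, ∃ K : ℝ, 0 < K ∧ ∀ u ∈ FreeI o (ulm I), ∀ f : LipI o (ulm I),
      supp (f : Lip o) ≤ E → |u f| ≤ ‖restrDual o (le_ulm I) u‖ * (K * ‖f‖) := by
    rintro E ⟨θ, hθ, hE⟩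
    exact ⟨1 + 1 / θ, by positivity, fun u hu f hf => abs_apply_le ho _ hθ hE f hf hu⟩
  have hcauchy : ∀ f : LipI o (ulm I),
      CauchySeq fun n => (v n : StrongDual ℝ (LipI o (ulm I))) f := by
    intro f
    obtain ⟨K, hK, hKb⟩ := hbound _ f.2
    refine Metric.cauchySeq_iff'.2 fun ε hε => ?_
    -- The `+ 1` keeps the divisor positive when `f = 0`.
    have hpos : 0 < K * ‖f‖ + 1 := by positivity
    obtain ⟨N, hN⟩ := Metric.cauchySeq_iff'.1 hlim'.cauchySeq (ε / (K * ‖f‖ + 1))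
      (by positivity)
    refine ⟨N, fun n hn => ?_⟩
    have h1 := hN n hn
    rw [dist_eq_norm, ← map_sub, lt_div_iff₀ hpos] at h1
    have h2 := hKb _ (Submodule.sub_mem _ (v n).2 (v N).2) f le_rfl
    rw [sub_apply] at h2
    rw [Real.dist_eq]
    refine h2.trans_lt (lt_of_le_of_lt ?_ h1)
    gcongr
    linarith
  choose φ hφ using fun f => cauchySeq_tendsto_of_complete (hcauchy f)
  let L : LipI o (ulm I) →ₗ[ℝ] ℝ :=
    { toFun := φ
      map_add' := fun f g => tendsto_nhds_unique (hφ (f + g)) (by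
        simpa using (hφ f).add (hφ g))
      map_smul' := fun c f => tendsto_nhds_unique (hφ (c • f)) (by
        simpa using (hφ f).const_mul c) }
  have hL : ∀ f, ‖L f‖ ≤ C * ‖f‖ := fun f => le_of_tendsto (hφ f).norm
    (Eventually.of_forall fun n =>
      ((v n : StrongDual ℝ (LipI o (ulm I))).le_opNorm f).trans (by gcongr; exact hv n))
  let u : StrongDual ℝ (LipI o (ulm I)) := L.mkContinuous C hL
  have hu : ∀ f, Tendsto (fun n => (v n : StrongDual ℝ (LipI o (ulm I))) f) atTop (𝓝 (u f)) := hφ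
  have htame : IsTame u := by
    intro E hE ε hε
    obtain ⟨K, hK, hKb⟩ := hbound E hE
    -- A finite combination of evaluations near `w` comes from the same combination `s` on `Lip_J`.
    -- For `g` vanishing on its points, `u g` is the limit of `(v n - s) g`, bounded through the
    -- restrictions.
    have himage : Submodule.span ℝ (Set.range (delta o I)) =
        (Submodule.span ℝ (Set.range (delta o (ulm I)))).map
          (restrDual o (le_ulm I)).toLinearMap := by
      rw [Submodule.map_span, ← Set.range_comp]
      rfl
    obtain ⟨_, hs', hws⟩ := Metric.mem_closure_iff.1 w.2 (ε / K) (by positivity)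
    rw [himage] at hs'
    obtain ⟨s, hs, rfl⟩ := hs'
    obtain ⟨F, hF⟩ := exists_finset_of_mem_span hs
    refine ⟨F, fun g hg h1 hgF => ?_⟩
    have hle : |u g| ≤ dist (w : StrongDual ℝ (LipI o I)) (restrDual o (le_ulm I) s) * K := by
      refine le_of_tendsto_of_tendsto' (hu g).abs ((hlim'.dist tendsto_const_nhds).mul_const K)
        fun n => ?_
      have h2 := hKb _ (Submodule.sub_mem _ (v n).2 (Submodule.le_topologicalClosure _ hs)) g hg
      rw [sub_apply, hF g hgF, sub_zero, map_sub, ← dist_eq_norm] at h2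
      exact h2.trans (by gcongr; exact mul_le_of_le_one_right hK.le h1)
    exact hle.trans ((lt_div_iff₀ hK).1 hws).le
  have huJ : u ∈ FreeI o (ulm I) := htame.mem_freeI
  refine ⟨⟨u, huJ⟩, L.mkContinuous_norm_le hC hL, Subtype.ext (ContinuousLinearMap.ext fun f => ?_)⟩
  refine tendsto_nhds_unique (hu (inclLip o (le_ulm I) f)) ?_
  exact ((ContinuousLinearMap.apply ℝ ℝ f).continuous.tendsto _).comp hlim'

end SemiEmbedding

end LipFree

theorem mainTheorem7 {X : Type*} [MetricSpace X] [DiscreteTopology X] [Countable X]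
    (hdiam : Metric.diam (Set.univ : Set X) = 1)
    (o : X) (ho : ∀ p : X, p ≠ o → dist o p = 1)
    (I : Order.Ideal (TopologicalSpace.Closeds X))
    (hFI : LipFree.finIdeal X ≤ I)
    (hinj : Function.Injective (LipFree.R o hFI)) :
    Function.Injective (LipFree.R o (hFI.trans (LipFree.le_ulm I))) ∧
      LipFree.IsSemiEmbedding 7 (LipFree.R o (LipFree.le_ulm I)) := by
  have ho' : ∀ p : X, dist p o ≤ 1 := fun p => by
    rcases eq_or_ne p o with rfl | h
    · simp
    · rw [dist_comm, ho p h]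
  have hR := LipFree.R_ulm_injective ho' I
  -- Restriction from `J` to the finite ideal factors definitionally through `I`.
  refine ⟨hinj.comp hR, by norm_num, hR, fun w hw => ?_⟩
  obtain ⟨x, hx, hlim⟩ := mem_closure_iff_seq_limit.1 hw
  choose v hv hvx using hx
  obtain ⟨u, hu, rfl⟩ := LipFree.exists_lift ho' (C := 1) (w := w) (v := v)
    (fun n => by simpa using hv n) (by simpa only [hvx] using hlim)
  refine ⟨u, ?_, rfl⟩
  rw [smul_closedBall _ _ zero_le_one]
  simp only [smul_zero, mem_closedBall_zero_iff]
  rw [Real.norm_of_nonneg (by norm_num), mul_one]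
  exact hu.trans (by norm_num)
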